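/- Let $d\ge 1$ and let $\ell\colon(0,\infty)\to(0,\infty)$ be a measurable function such that $\int_0^\infty \ell(s)\,\frac{ds}{s}=+\infty$, $\int_r^\infty \ell(s)\,\frac{ds}{s}<+\infty$ for every $r>0$, and, for some constants $c_L\in(0,1)$, $c_U\ge 1$, $\gamma\in(0,2)$, $$c_L\,\lambda^{-\gamma}\ \le\ \frac{\ell(r\lambda)}{\ell(r)}\ \le\ c_U\,\lambda^{d}\qquad\text{for all } r>0,\ \lambda\ge 1 .$$ Let $K\colon\mathbb R^d\times(\mathbb R^d\setminus\{0\})\to[0,\infty)$ be a measurable function with $K(x,h)=K(x,-h)$ for all $x,h$ such that, for some constant $\kappa\ge 1$, $$\kappa^{-1}|h|^{-d}\ell(|h|)\ \le\ K(x,h)\ \le\ \kappa\,|h|^{-d}\ell(|h|)\qquad\text{for all } x\in\mathbb R^d,\ h\in\mathbb R^d\setminus\{0\}.$$ For $u\in C^2_b(\mathbb R^d)$, i.e. $u\colon\mathbb R^d\to\mathbb R$ twice continuously differentiable and bounded together with its first and second derivatives, put $$Au(x)=\int_{\mathbb R^d\setminus\{0\}}\big(u(x+h)-u(x)-\langle\nabla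 u(x),h\rangle\mathbf 1_{B_1}(h)\big)K(x,h)\,dh ,\qquad x\in\mathbb R^d,$$ where $B_1$ is the open unit ball centred at $0$. If $u\in C^2_b(\mathbb R^d)$ satisfies $Au(x)=0$ for every $x\in\mathbb R^d$, then $u$ is constant. -/

import Mathlib

open MeasureTheory Set
open scoped ENNReal

namespace NonlocalLiouville

/-- `ℝ^d` with its Euclidean norm and inner product. -/
abbrev Rd (d : ℕ) : Type := EuclideanSpace ℝ (Fin d)

/-- The conditions on the function `ℓ : (0, ∞) → (0, ∞)` (the case `R₀ = +∞`). Only the values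
of `ℓ` on `(0, ∞)` matter. -/
structure IsScaleFunction (d : ℕ) (ℓ : ℝ → ℝ) (cL cU γ : ℝ) : Prop where
  cL_mem : cL ∈ Ioo (0 : ℝ) 1
  one_le_cU : 1 ≤ cU
  γ_mem : γ ∈ Ioo (0 : ℝ) 2
  aemeasurable : AEMeasurable ℓ (volume.restrict (Ioi 0))
  pos : ∀ s : ℝ, 0 < s → 0 < ℓ s
  /-- `∫_0^∞ ℓ(s) ds/s = +∞` -/
  lintegral_zero : ∫⁻ s in Ioi (0 : ℝ), ENNReal.ofReal (ℓ s / s) = ∞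
  /-- `∫_r^∞ ℓ(s) ds/s < +∞` for `r > 0` -/
  lintegral_lt : ∀ r : ℝ, 0 < r → ∫⁻ s in Ioi r, ENNReal.ofReal (ℓ s / s) < ∞
  /-- `ℓ(r lam) / ℓ(r) ≥ cL lam^(-γ)` for `r > 0`, `lam ≥ 1` -/
  lower_scaling : ∀ r lam : ℝ, 0 < r → 1 ≤ lam → cL * lam ^ (-γ) ≤ ℓ (r * lam) / ℓ r
  /-- `ℓ(r lam) / ℓ(r) ≤ cU lam^d` for `r > 0`, `lam ≥ 1` -/
  upper_scaling : ∀ r lam : ℝ, 0 < r → 1 ≤ lam → ℓ (r * lam) / ℓ r ≤ cU * lam ^ d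

/-- `K : ℝ^d × (ℝ^d \ {0}) → [0, ∞)` is measurable and `K(x, h) = K(x, -h)`. The values
`K x 0` play no role. -/
structure IsSymmetricKernel {d : ℕ} (K : Rd d → Rd d → ℝ) : Prop where
  measurable : Measurable fun p : Rd d × {h : Rd d // h ≠ 0} => K p.1 p.2
  nonneg : ∀ x h : Rd d, h ≠ 0 → 0 ≤ K x h
  symmetric : ∀ x h : Rd d, h ≠ 0 → K x h = K x (-h)

/-- The two-sided comparison (case `R₀ = +∞`):
`κ⁻¹ |h|^(-d) ℓ(|h|) ≤ K(x, h) ≤ κ |h|^(-d) ℓ(|h|)` for all `x` and all `h ≠ 0`. -/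
def KernelComparable {d : ℕ} (K : Rd d → Rd d → ℝ) (ℓ : ℝ → ℝ) (κ : ℝ) : Prop :=
  ∀ x h : Rd d, h ≠ 0 →
    κ⁻¹ * ((‖h‖ ^ d)⁻¹ * ℓ ‖h‖) ≤ K x h ∧ K x h ≤ κ * ((‖h‖ ^ d)⁻¹ * ℓ ‖h‖)

/-- `u ∈ C²_b(ℝ^d)`: `u` is twice continuously differentiable, and `u` and its derivatives of
order one and two are bounded. -/
def IsC2b {d : ℕ} (u : Rd d → ℝ) : Prop :=
  ContDiff ℝ 2 u ∧ ∀ k : ℕ, k ≤ 2 → ∃ C : ℝ, ∀ x, ‖iteratedFDeriv ℝ k u x‖ ≤ C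

/-- The operator
`A u(x) = ∫_{ℝ^d \ {0}} (u(x+h) - u(x) - ⟨∇u(x), h⟩ 1_{B_1}(h)) K(x, h) dh`. -/
noncomputable def nonlocalOp {d : ℕ} (K : Rd d → Rd d → ℝ) (u : Rd d → ℝ) (x : Rd d) : ℝ :=
  ∫ h in ({0}ᶜ : Set (Rd d)),
    (u (x + h) - u x - (Metric.ball (0 : Rd d) 1).indicator (fun h => inner ℝ (gradient u x) h) h)
      * K x h

end NonlocalLiouville

/-! Let `M` and `m` be the supremum and infimum of `u`, and suppose `m < M`. The nonnegative
functions `M - u` and `u - m` add up to `M - m`, so for each radius `r` one of them, `w`, has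
average at least `(M - m) / 2` against the jump kernel restricted to `|y| > r`. A growth lemma
(`ge_of_outer_mass`) turns this outer mass into a bound `w ≥ 3t/4` on the ball of radius `r/4`, with
`t > 0` independent of `r`. For `r` large that ball contains points where `M - u` and `u - m` are
both below `3t/4`, a contradiction.

The growth lemma touches `w` from below by a bump of height `t` and width `r`. At the contact point
the equation balances the mass arriving from `|y| > r` against the bump's cost, of order `t ∫ min(1,
|h|²/r²) |h|^(-d) ℓ(|h|) dh`. Since `γ < 2`, this integral is at most a constant times the outer
mass of the kernel, uniformly in `r` (`integral_quadratic_le`); hence `t` does not depend on `r`. -/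

namespace NonlocalLiouville

/-! ### One-dimensional scale integrals of `ℓ`. -/

namespace IsScaleFunction

variable {d : ℕ} {ℓ : ℝ → ℝ} {cL cU γ : ℝ}

theorem integrableOn_Ioi (hℓ : IsScaleFunction d ℓ cL cU γ) {r : ℝ} (hr : 0 < r) :
    IntegrableOn (fun s => ℓ s / s) (Ioi r) := by
  have hm : AEMeasurable (fun s => ℓ s / s) (volume.restrict (Ioi r)) :=
    (hℓ.aemeasurable.mono_measure
      (Measure.restrict_mono (Ioi_subset_Ioi hr.le) le_rfl)).div aemeasurable_id
  refine ⟨hm.aestronglyMeasurable, ?_⟩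
  rw [hasFiniteIntegral_iff_ofReal]
  · exact hℓ.lintegral_lt r hr
  · filter_upwards [ae_restrict_mem measurableSet_Ioi] with s hs
    exact div_nonneg (hℓ.pos s (hr.trans hs)).le (hr.trans hs).le

theorem le_of_le (hℓ : IsScaleFunction d ℓ cL cU γ) {s r : ℝ} (hs : 0 < s) (hsr : s ≤ r) :
    ℓ s ≤ cL⁻¹ * (r / s) ^ γ * ℓ r := by
  have hr := hs.trans_le hsr
  have h := hℓ.lower_scaling s (r / s) hs ((one_le_div hs).2 hsr)
  rw [mul_div_cancel₀ _ hs.ne', Real.rpow_neg (by positivity), le_div_iff₀ (hℓ.pos s hs)] at h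
  have hc := hℓ.cL_mem.1
  have hp : 0 < (r / s) ^ γ := Real.rpow_pos_of_pos (by positivity) _
  calc ℓ s = cL⁻¹ * (r / s) ^ γ * (cL * ((r / s) ^ γ)⁻¹ * ℓ s) := by field_simp
    _ ≤ _ := by gcongr

theorem quadratic_near_zero_le (hℓ : IsScaleFunction d ℓ cL cU γ) {s r : ℝ} (hs : 0 < s)
    (hsr : s ≤ r) :
    min 1 ((s / r) ^ 2) * (ℓ s / s) ≤ cL⁻¹ * r ^ (γ - 2) * ℓ r * s ^ (1 - γ) := by
  have hr := hs.trans_le hsr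
  calc min 1 ((s / r) ^ 2) * (ℓ s / s) ≤ (s / r) ^ 2 * ((cL⁻¹ * (r / s) ^ γ * ℓ r) / s) := by
        have := (hℓ.pos s hs).le
        gcongr
        · exact min_le_right _ _
        · exact hℓ.le_of_le hs hsr
    _ = _ := by
        rw [Real.div_rpow hr.le hs.le, Real.rpow_sub hr, Real.rpow_sub hs, Real.rpow_one,
          Real.rpow_two]
        have := (Real.rpow_pos_of_pos hs γ).ne'
        field_simp

theorem integrableOn_rpow_Ioc (hℓ : IsScaleFunction d ℓ cL cU γ) {r : ℝ} (hr : 0 < r) :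
    IntegrableOn (fun s : ℝ => s ^ (1 - γ)) (Ioc 0 r) :=
  (intervalIntegrable_iff_integrableOn_Ioc_of_le hr.le).1
    (intervalIntegral.intervalIntegrable_rpow' (by linarith [hℓ.γ_mem.2]))

theorem integrableOn_quadratic_Ioc (hℓ : IsScaleFunction d ℓ cL cU γ) {r : ℝ} (hr : 0 < r) :
    IntegrableOn (fun s => min 1 ((s / r) ^ 2) * (ℓ s / s)) (Ioc 0 r) := by
  refine ((hℓ.integrableOn_rpow_Ioc hr).const_mul (cL⁻¹ * r ^ (γ - 2) * ℓ r)).mono' ?_ ?_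
  · refine AEMeasurable.aestronglyMeasurable ?_
    refine AEMeasurable.mul (by fun_prop) (AEMeasurable.div ?_ aemeasurable_id)
    exact hℓ.aemeasurable.mono_measure (Measure.restrict_mono Ioc_subset_Ioi_self le_rfl)
  · filter_upwards [ae_restrict_mem measurableSet_Ioc] with s hs
    rw [Real.norm_of_nonneg
      (mul_nonneg (by positivity) (div_nonneg (hℓ.pos s hs.1).le hs.1.le))]
    exact hℓ.quadratic_near_zero_le hs.1 hs.2

theorem min_one_sq_eq {r s : ℝ} (hr : 0 < r) (hs : r < s) : min 1 ((s / r) ^ 2) = 1 := by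
  have : 1 ≤ s / r := (one_le_div hr).2 hs.le
  exact min_eq_left (by nlinarith)

theorem integrableOn_quadratic_Ioi (hℓ : IsScaleFunction d ℓ cL cU γ) {r : ℝ} (hr : 0 < r) :
    IntegrableOn (fun s => min 1 ((s / r) ^ 2) * (ℓ s / s)) (Ioi r) :=
  (hℓ.integrableOn_Ioi hr).congr_fun
    (fun s hs => by simp only [min_one_sq_eq hr hs, one_mul]) measurableSet_Ioi

theorem integrableOn_quadratic (hℓ : IsScaleFunction d ℓ cL cU γ) {r : ℝ} (hr : 0 < r) :
    IntegrableOn (fun s => min 1 ((s / r) ^ 2) * (ℓ s / s)) (Ioi 0) := by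
  rw [← Ioc_union_Ioi_eq_Ioi hr.le]
  exact (hℓ.integrableOn_quadratic_Ioc hr).union (hℓ.integrableOn_quadratic_Ioi hr)

theorem integral_quadratic_Ioc_le (hℓ : IsScaleFunction d ℓ cL cU γ) {r : ℝ} (hr : 0 < r) :
    ∫ s in Ioc 0 r, min 1 ((s / r) ^ 2) * (ℓ s / s) ≤ (cL * (2 - γ))⁻¹ * ℓ r := by
  have hγ : 0 < 2 - γ := by linarith [hℓ.γ_mem.2]
  calc ∫ s in Ioc 0 r, min 1 ((s / r) ^ 2) * (ℓ s / s)
      ≤ ∫ s in Ioc 0 r, cL⁻¹ * r ^ (γ - 2) * ℓ r * s ^ (1 - γ) :=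
        setIntegral_mono_on (hℓ.integrableOn_quadratic_Ioc hr)
          ((hℓ.integrableOn_rpow_Ioc hr).const_mul _) measurableSet_Ioc
          fun s hs => hℓ.quadratic_near_zero_le hs.1 hs.2
    _ = (cL * (2 - γ))⁻¹ * ℓ r := by
        rw [integral_const_mul, ← intervalIntegral.integral_of_le hr.le,
          integral_rpow (Or.inl (by linarith)), show 1 - γ + 1 = 2 - γ by ring,
          Real.zero_rpow hγ.ne', show γ - 2 = -(2 - γ) by ring, Real.rpow_neg hr.le]
        have := (Real.rpow_pos_of_pos hr (2 - γ)).ne'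
        have := hℓ.cL_mem.1.ne'
        field_simp
        ring

/-- Lower scaling keeps `ℓ` comparable from below to `ℓ r` on `(r, 2r]`, and this interval alone
gives the bound. -/
theorem le_integral_Ioi (hℓ : IsScaleFunction d ℓ cL cU γ) {r : ℝ} (hr : 0 < r) :
    cL * ((2 : ℝ) ^ γ)⁻¹ / 2 * ℓ r ≤ ∫ s in Ioi r, ℓ s / s := by
  have hc := hℓ.cL_mem.1
  have h2 : (0 : ℝ) < 2 ^ γ := Real.rpow_pos_of_pos two_pos _
  calc cL * ((2 : ℝ) ^ γ)⁻¹ / 2 * ℓ r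
      = ∫ _ in Ioc r (2 * r), cL * ((2 : ℝ) ^ γ)⁻¹ * ℓ r / (2 * r) := by
        rw [setIntegral_const, Real.volume_real_Ioc_of_le (by linarith), smul_eq_mul]
        field_simp
        ring
    _ ≤ ∫ s in Ioc r (2 * r), ℓ s / s := by
        refine setIntegral_mono_on (by simp) ((hℓ.integrableOn_Ioi hr).mono_set
          Ioc_subset_Ioi_self) measurableSet_Ioc fun s hs => ?_
        have hs0 := hr.trans hs.1
        refine div_le_div₀ (hℓ.pos s hs0).le ?_ hs0 hs.2
        have h := hℓ.le_of_le hr hs.1.le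
        have h1 : (s / r) ^ γ ≤ 2 ^ γ :=
          Real.rpow_le_rpow (by positivity) (by rw [div_le_iff₀ hr]; exact hs.2) hℓ.γ_mem.1.le
        have := (hℓ.pos s hs0)
        calc cL * ((2 : ℝ) ^ γ)⁻¹ * ℓ r ≤ cL * ((2 : ℝ) ^ γ)⁻¹ * (cL⁻¹ * 2 ^ γ * ℓ s) := by
              gcongr; exact h.trans (by gcongr)
          _ = ℓ s := by field_simp
    _ ≤ _ := by
        refine setIntegral_mono_set (hℓ.integrableOn_Ioi hr) ?_
          Ioc_subset_Ioi_self.eventuallyLE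
        filter_upwards [ae_restrict_mem measurableSet_Ioi] with s hs
        exact div_nonneg (hℓ.pos s (hr.trans hs)).le (hr.trans hs).le

/-- Below `r` the integrand is dominated by a multiple of `s ^ (1 - γ)`, integrable at zero because
`γ < 2`; this part costs a multiple of `ℓ r`, which the tail absorbs. The constant is free of `r`.
-/
theorem integral_quadratic_le (hℓ : IsScaleFunction d ℓ cL cU γ) {r : ℝ} (hr : 0 < r) :
    ∫ s in Ioi 0, min 1 ((s / r) ^ 2) * (ℓ s / s) ≤
      ((cL * (2 - γ))⁻¹ * (cL * ((2 : ℝ) ^ γ)⁻¹ / 2)⁻¹ + 1) * ∫ s in Ioi r, ℓ s / s := by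
  have hc := hℓ.cL_mem.1
  have hγ : 0 < 2 - γ := by linarith [hℓ.γ_mem.2]
  have h2 : (0 : ℝ) < 2 ^ γ := Real.rpow_pos_of_pos two_pos _
  rw [← Ioc_union_Ioi_eq_Ioi hr.le, setIntegral_union (Ioc_disjoint_Ioi le_rfl) measurableSet_Ioi
    (hℓ.integrableOn_quadratic_Ioc hr) (hℓ.integrableOn_quadratic_Ioi hr), add_mul, one_mul]
  refine add_le_add ?_ (setIntegral_congr_fun measurableSet_Ioi
    fun s hs => by simp only [min_one_sq_eq hr hs, one_mul]).le
  refine (hℓ.integral_quadratic_Ioc_le hr).trans ?_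
  rw [mul_assoc]
  gcongr
  rw [le_inv_mul_iff₀ (by positivity)]
  exact hℓ.le_integral_Ioi hr

end IsScaleFunction

/-! ### Radial kernels in `ℝ^d`, in polar coordinates. -/

/-- The radial comparison kernel `|h|^(-d) ℓ(|h|)`. -/
noncomputable def radialKernel (d : ℕ) (ℓ : ℝ → ℝ) (h : Rd d) : ℝ := (‖h‖ ^ d)⁻¹ * ℓ ‖h‖

/-- The radial comparison kernel restricted to `|h| > r`. -/
noncomputable def outerKernel (d : ℕ) (ℓ : ℝ → ℝ) (r : ℝ) (h : Rd d) : ℝ :=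
  (Ioi r).indicator (fun s => (s ^ d)⁻¹ * ℓ s) ‖h‖

theorem outerKernel_of_lt {d : ℕ} (ℓ : ℝ → ℝ) {r : ℝ} {h : Rd d} (hr : r < ‖h‖) :
    outerKernel d ℓ r h = radialKernel d ℓ h := indicator_of_mem (mem_Ioi.2 hr) _

theorem outerKernel_of_le {d : ℕ} (ℓ : ℝ → ℝ) {r : ℝ} {h : Rd d} (hr : ‖h‖ ≤ r) :
    outerKernel d ℓ r h = 0 := indicator_of_notMem (notMem_Ioi.2 hr) _

theorem pow_pred_mul_inv_pow {d : ℕ} [NeZero d] {s : ℝ} (hs : 0 < s) (a : ℝ) :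
    s ^ (d - 1) * ((s ^ d)⁻¹ * a) = a / s := by
  obtain ⟨n, rfl⟩ := Nat.exists_eq_succ_of_ne_zero (NeZero.ne d)
  simp only [Nat.succ_eq_add_one, Nat.add_sub_cancel, pow_succ]
  field_simp

theorem eqOn_quadratic {d : ℕ} [NeZero d] (ℓ : ℝ → ℝ) (r : ℝ) :
    EqOn (fun s : ℝ => s ^ (Module.finrank ℝ (Rd d) - 1) •
      (min 1 ((s / r) ^ 2) * ((s ^ d)⁻¹ * ℓ s)))
      (fun s => min 1 ((s / r) ^ 2) * (ℓ s / s)) (Ioi 0) := fun s hs => by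
  simp only [finrank_euclideanSpace_fin, smul_eq_mul]
  rw [mul_left_comm, pow_pred_mul_inv_pow hs]

theorem eqOn_outer {d : ℕ} [NeZero d] (ℓ : ℝ → ℝ) (r : ℝ) :
    EqOn (fun s : ℝ => s ^ (Module.finrank ℝ (Rd d) - 1) •
      (Ioi r).indicator (fun s => (s ^ d)⁻¹ * ℓ s) s)
      ((Ioi r).indicator fun s => ℓ s / s) (Ioi 0) := fun s hs => by
  by_cases h : s ∈ Ioi r
  · simp only [finrank_euclideanSpace_fin, smul_eq_mul, indicator_of_mem h]
    exact pow_pred_mul_inv_pow hs _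
  · simp only [indicator_of_notMem h, smul_zero]

theorem finrank_smul_ball_pos (d : ℕ) [NeZero d] :
    0 < (Module.finrank ℝ (Rd d) : ℝ) * volume.real (Metric.ball (0 : Rd d) 1) := by
  rw [finrank_euclideanSpace_fin]
  have h : (0 : ℝ) < d := by exact_mod_cast Nat.pos_of_ne_zero (NeZero.ne d)
  exact mul_pos h (ENNReal.toReal_pos (Metric.measure_ball_pos _ _ one_pos).ne'
    measure_ball_lt_top.ne)

namespace IsScaleFunction

variable {d : ℕ} {ℓ : ℝ → ℝ} {cL cU γ : ℝ}

theorem radialKernel_pos (hℓ : IsScaleFunction d ℓ cL cU γ) {h : Rd d} (hh : h ≠ 0) :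
    0 < radialKernel d ℓ h := by
  have := norm_pos_iff.2 hh
  exact mul_pos (by positivity) (hℓ.pos _ this)

theorem integrable_quadratic_radialKernel [NeZero d] (hℓ : IsScaleFunction d ℓ cL cU γ) {r : ℝ}
    (hr : 0 < r) : Integrable fun h : Rd d => min 1 ((‖h‖ / r) ^ 2) * radialKernel d ℓ h := by
  refine (integrable_fun_norm_addHaar (E := Rd d) volume
    (f := fun s => min 1 ((s / r) ^ 2) * ((s ^ d)⁻¹ * ℓ s))).2 ?_
  exact (hℓ.integrableOn_quadratic hr).congr_fun (eqOn_quadratic ℓ r).symm measurableSet_Ioi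

theorem integrable_outerKernel [NeZero d] (hℓ : IsScaleFunction d ℓ cL cU γ) {r : ℝ}
    (hr : 0 < r) : Integrable (outerKernel d ℓ r) := by
  refine (integrable_fun_norm_addHaar (E := Rd d) volume
    (f := (Ioi r).indicator fun s => (s ^ d)⁻¹ * ℓ s)).2 ?_
  refine IntegrableOn.congr_fun ?_ (eqOn_outer ℓ r).symm measurableSet_Ioi
  exact ((integrable_indicator_iff measurableSet_Ioi).2 (hℓ.integrableOn_Ioi hr)).integrableOn

theorem integral_outerKernel [NeZero d] {r : ℝ} (hr : 0 < r) :
    ∫ h, outerKernel d ℓ r h = (Module.finrank ℝ (Rd d) : ℝ) *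
      volume.real (Metric.ball (0 : Rd d) 1) * ∫ s in Ioi r, ℓ s / s := by
  refine (integral_fun_norm_addHaar (E := Rd d) volume
    ((Ioi r).indicator fun s => (s ^ d)⁻¹ * ℓ s)).trans ?_
  rw [setIntegral_congr_fun measurableSet_Ioi (eqOn_outer ℓ r),
    setIntegral_indicator measurableSet_Ioi, inter_eq_right.2 (Ioi_subset_Ioi hr.le),
    nsmul_eq_mul, smul_eq_mul, mul_assoc]

theorem integral_quadratic_radialKernel_le [NeZero d] (hℓ : IsScaleFunction d ℓ cL cU γ) {r : ℝ}
    (hr : 0 < r) : ∫ h : Rd d, min 1 ((‖h‖ / r) ^ 2) * radialKernel d ℓ h ≤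
      ((cL * (2 - γ))⁻¹ * (cL * ((2 : ℝ) ^ γ)⁻¹ / 2)⁻¹ + 1) * ∫ h, outerKernel d ℓ r h := by
  refine (integral_fun_norm_addHaar (E := Rd d) volume
    (fun s => min 1 ((s / r) ^ 2) * ((s ^ d)⁻¹ * ℓ s))).trans_le ?_
  rw [setIntegral_congr_fun measurableSet_Ioi (eqOn_quadratic ℓ r), integral_outerKernel hr,
    nsmul_eq_mul, smul_eq_mul, ← mul_assoc, mul_left_comm]
  exact mul_le_mul_of_nonneg_left (hℓ.integral_quadratic_le hr) (finrank_smul_ball_pos d).le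

theorem integral_outerKernel_pos [NeZero d] (hℓ : IsScaleFunction d ℓ cL cU γ) {r : ℝ}
    (hr : 0 < r) : 0 < ∫ h, outerKernel d ℓ r h := by
  rw [integral_outerKernel hr]
  refine mul_pos (finrank_smul_ball_pos d) (lt_of_lt_of_le ?_ (hℓ.le_integral_Ioi hr))
  have := hℓ.cL_mem.1
  have := hℓ.pos r hr
  have : (0 : ℝ) < 2 ^ γ := Real.rpow_pos_of_pos two_pos _
  positivity

/-- If `‖h‖ ≤ ‖x + h‖`, the factor `lam ^ d` of upper scaling is exactly compensated by the weight
`‖·‖ ^ (-d)`. Otherwise `‖h‖ ≤ 2‖x + h‖` and lower scaling suffices. The constant adds the two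
cases. -/
theorem radialKernel_translate_le (hℓ : IsScaleFunction d ℓ cL cU γ) {r : ℝ} (hr : 0 < r)
    {x h : Rd d} (hx : ‖x‖ ≤ r / 2) (hxh : r < ‖x + h‖) :
    radialKernel d ℓ (x + h) ≤ (cU + 2 ^ d * (cL⁻¹ * 2 ^ γ)) * radialKernel d ℓ h := by
  have h1 : ‖x + h‖ ≤ ‖x‖ + ‖h‖ := norm_add_le _ _
  have h2 : ‖h‖ ≤ ‖x + h‖ + ‖x‖ := by simpa using norm_sub_le (x + h) x
  have hh0 : 0 < ‖h‖ := by linarith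
  have hy0 : 0 < ‖x + h‖ := hr.trans hxh
  have hc := hℓ.cL_mem.1
  have hU := hℓ.one_le_cU
  have hp : (0 : ℝ) < 2 ^ γ := Real.rpow_pos_of_pos two_pos _
  have hℓh := hℓ.pos _ hh0
  have hJ : 0 < (‖h‖ ^ d)⁻¹ * ℓ ‖h‖ := by positivity
  rw [add_mul]
  simp only [radialKernel]
  rcases le_total ‖h‖ ‖x + h‖ with hle | hle
  · refine le_add_of_le_of_nonneg ?_ (by positivity)
    have := hℓ.upper_scaling ‖h‖ (‖x + h‖ / ‖h‖) hh0 ((one_le_div hh0).2 hle)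
    rw [mul_div_cancel₀ _ hh0.ne', div_le_iff₀ hℓh] at this
    calc (‖x + h‖ ^ d)⁻¹ * ℓ ‖x + h‖
        ≤ (‖x + h‖ ^ d)⁻¹ * (cU * (‖x + h‖ / ‖h‖) ^ d * ℓ ‖h‖) := by gcongr
      _ = _ := by rw [div_pow]; field_simp
  · refine le_add_of_nonneg_of_le (by positivity) ?_
    have hratio : ‖h‖ / ‖x + h‖ ≤ 2 := by rw [div_le_iff₀ hy0]; linarith
    calc (‖x + h‖ ^ d)⁻¹ * ℓ ‖x + h‖
        ≤ (2 ^ d * (‖h‖ ^ d)⁻¹) * (cL⁻¹ * 2 ^ γ * ℓ ‖h‖) := by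
          have := (hℓ.pos _ hy0).le
          refine mul_le_mul ?_ ((hℓ.le_of_le hy0 hle).trans ?_) this (by positivity)
          · rw [← div_eq_mul_inv, ← div_pow, ← inv_pow]
            refine pow_le_pow_left₀ (by positivity) ?_ d
            rw [inv_eq_one_div, div_le_div_iff₀ hy0 hh0]
            linarith
          · have := hℓ.γ_mem.1.le
            gcongr
      _ = _ := by ring

end IsScaleFunction

/-! ### The operator as an integral of second differences. -/

theorem IsC2b.exists_bound {d : ℕ} {u : Rd d → ℝ} (hu : IsC2b u) : ∃ C, ∀ x, |u x| ≤ C := by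
  obtain ⟨C, hC⟩ := hu.2 0 (by norm_num)
  exact ⟨C, fun x => by simpa using hC x⟩

theorem IsC2b.exists_taylor_bound {d : ℕ} {u : Rd d → ℝ} (hu : IsC2b u) :
    ∃ C, 0 ≤ C ∧ ∀ x h, |u (x + h) - u x - inner ℝ (gradient u x) h| ≤ C * ‖h‖ ^ 2 := by
  obtain ⟨C, hC⟩ := hu.2 2 le_rfl
  have hC0 : 0 ≤ C := (norm_nonneg _).trans (hC 0)
  have hd : Differentiable ℝ u := hu.1.differentiable (by norm_num)
  have hd' : Differentiable ℝ (fderiv ℝ u) :=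
    (hu.1.fderiv_right (m := 1) (by norm_num)).differentiable (by norm_num)
  have hb (x : Rd d) : ‖fderiv ℝ (fderiv ℝ u) x‖ ≤ C := by
    have := hC x
    rwa [← norm_iteratedFDeriv_fderiv, ← norm_iteratedFDeriv_fderiv,
      norm_iteratedFDeriv_zero] at this
  have hlip (x y : Rd d) : ‖fderiv ℝ u y - fderiv ℝ u x‖ ≤ C * ‖y - x‖ :=
    convex_univ.norm_image_sub_le_of_norm_fderiv_le (fun z _ => hd' z) (fun z _ => hb z)
      (mem_univ x) (mem_univ y)
  refine ⟨C, hC0, fun x h => ?_⟩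
  -- On the ball of radius `‖h‖` about `x` the derivative stays within `C * ‖h‖` of its value at
  -- `x`.
  have key := (convex_closedBall x ‖h‖).norm_image_sub_le_of_norm_fderiv_le' (𝕜 := ℝ) (f := u)
    (φ := fderiv ℝ u x) (C := C * ‖h‖) (x := x) (y := x + h) (fun z _ => hd z)
    (fun z hz => (hlip x z).trans (by gcongr; simpa [dist_eq_norm] using hz))
    (by simp) (by simp [dist_eq_norm])
  have hg : inner ℝ (gradient u x) h = fderiv ℝ u x h := by
    simp [gradient]
  rw [hg]
  simpa [pow_two, mul_assoc] using key

/-- The symmetric second difference `u(x+h) + u(x-h) - 2u(x)`. -/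
def secondDiff {d : ℕ} (u : Rd d → ℝ) (x h : Rd d) : ℝ := u (x + h) + u (x - h) - 2 * u x

theorem IsSymmetricKernel.aestronglyMeasurable {d : ℕ} [NeZero d] {K : Rd d → Rd d → ℝ}
    (hK : IsSymmetricKernel K) (x : Rd d) : AEStronglyMeasurable (K x) := by
  have h : AEMeasurable (K x) (volume.restrict {0}ᶜ) :=
    aemeasurable_restrict_of_measurable_subtype (measurableSet_singleton _).compl
      (hK.measurable.comp (measurable_const.prodMk measurable_id))
  rw [restrict_compl_singleton] at h
  exact h.aestronglyMeasurable

theorem integrable_nonlocalOp {d : ℕ} [NeZero d] {ℓ : ℝ → ℝ} {cL cU γ κ : ℝ}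
    {K : Rd d → Rd d → ℝ} (hℓ : IsScaleFunction d ℓ cL cU γ) (hK : IsSymmetricKernel K)
    (hA1 : KernelComparable K ℓ κ) {u : Rd d → ℝ} (hu : IsC2b u) (x : Rd d) :
    Integrable fun h => (u (x + h) - u x -
      (Metric.ball (0 : Rd d) 1).indicator (fun h => inner ℝ (gradient u x) h) h) * K x h := by
  obtain ⟨B, hB⟩ := hu.exists_bound
  obtain ⟨C, hC0, hC⟩ := hu.exists_taylor_bound
  have hB0 : 0 ≤ B := (abs_nonneg _).trans (hB 0)
  have hcont : Continuous u := hu.1.continuous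
  refine ((hℓ.integrable_quadratic_radialKernel one_pos).const_mul ((C + 2 * B) * κ)).mono' ?_ ?_
  · refine AEStronglyMeasurable.mul (AEStronglyMeasurable.sub ?_ ?_) (hK.aestronglyMeasurable x)
    · exact Continuous.aestronglyMeasurable (by fun_prop)
    · exact (Continuous.aestronglyMeasurable (by fun_prop)).indicator measurableSet_ball
  · have : ∀ᵐ h : Rd d, h ≠ 0 := by simp [ae_iff]
    filter_upwards [this] with h hh
    rw [norm_mul, Real.norm_eq_abs, Real.norm_of_nonneg (hK.nonneg x h hh)]
    have h1 : |u (x + h) - u x -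
        (Metric.ball (0 : Rd d) 1).indicator (fun h => inner ℝ (gradient u x) h) h| ≤
        (C + 2 * B) * min 1 ((‖h‖ / 1) ^ 2) := by
      rw [div_one]
      by_cases hb : h ∈ Metric.ball (0 : Rd d) 1
      · have hn : ‖h‖ < 1 := by simpa using hb
        rw [indicator_of_mem hb, min_eq_right (by nlinarith [norm_nonneg h])]
        exact (hC x h).trans (by gcongr; linarith)
      · have hn : 1 ≤ ‖h‖ := by simpa using hb
        rw [indicator_of_notMem hb, min_eq_left (by nlinarith), sub_zero, mul_one]
        linarith [abs_sub (u (x + h)) (u x), hB (x + h), hB x]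
    calc _ ≤ (C + 2 * B) * min 1 ((‖h‖ / 1) ^ 2) * (κ * radialKernel d ℓ h) :=
          mul_le_mul h1 (hA1 x h hh).2 (hK.nonneg x h hh) (by positivity)
      _ = _ := by ring

/-- Pairing `h` with `-h` cancels the gradient term, as `K x` is even and the unit ball symmetric.
-/
theorem secondDiff_mul_eq {d : ℕ} {K : Rd d → Rd d → ℝ} (hK : IsSymmetricKernel K)
    (u : Rd d → ℝ) (x h : Rd d) :
    (u (x + h) - u x -
      (Metric.ball (0 : Rd d) 1).indicator (fun h => inner ℝ (gradient u x) h) h) * K x h +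
    (u (x + -h) - u x -
      (Metric.ball (0 : Rd d) 1).indicator (fun h => inner ℝ (gradient u x) h) (-h)) * K x (-h) =
    secondDiff u x h * K x h := by
  rcases eq_or_ne h 0 with rfl | hh
  · simp [secondDiff]; ring_nf; simp
  · rw [← hK.symmetric x h hh]
    by_cases hb : h ∈ Metric.ball (0 : Rd d) 1
    · have hb' : -h ∈ Metric.ball (0 : Rd d) 1 := by simpa using hb
      simp only [indicator_of_mem hb, indicator_of_mem hb', inner_neg_right, secondDiff,
        sub_eq_add_neg x h]
      ring
    · have hb' : -h ∉ Metric.ball (0 : Rd d) 1 := by simpa using hb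
      simp only [indicator_of_notMem hb, indicator_of_notMem hb', secondDiff,
        sub_eq_add_neg x h]
      ring

theorem integrable_secondDiff {d : ℕ} [NeZero d] {ℓ : ℝ → ℝ} {cL cU γ κ : ℝ}
    {K : Rd d → Rd d → ℝ} (hℓ : IsScaleFunction d ℓ cL cU γ) (hK : IsSymmetricKernel K)
    (hA1 : KernelComparable K ℓ κ) {u : Rd d → ℝ} (hu : IsC2b u) (x : Rd d) :
    Integrable fun h => secondDiff u x h * K x h := by
  have h := integrable_nonlocalOp hℓ hK hA1 hu x
  exact (h.add h.comp_neg).congr (.of_forall (secondDiff_mul_eq hK u x))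

theorem integral_secondDiff {d : ℕ} [NeZero d] {ℓ : ℝ → ℝ} {cL cU γ κ : ℝ}
    {K : Rd d → Rd d → ℝ} (hℓ : IsScaleFunction d ℓ cL cU γ) (hK : IsSymmetricKernel K)
    (hA1 : KernelComparable K ℓ κ) {u : Rd d → ℝ} (hu : IsC2b u) (x : Rd d) :
    ∫ h, secondDiff u x h * K x h = 2 * nonlocalOp K u x := by
  have h := integrable_nonlocalOp hℓ hK hA1 hu x
  rw [← integral_congr_ae (.of_forall (secondDiff_mul_eq hK u x)),
    integral_add h h.comp_neg, integral_neg_eq_self (μ := volume) (fun h => (u (x + h) - u x -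
      (Metric.ball (0 : Rd d) 1).indicator (fun h => inner ℝ (gradient u x) h) h) * K x h),
    nonlocalOp, restrict_compl_singleton]
  ring

/-! ### Touching by a paraboloid and the growth lemma. -/

/-- The bump is at least `3/4 * t` at `x₀`, so the minimum over the ball of radius `r / 2` is
negative. Outside that ball the bump vanishes and `w ≥ 0`, so the minimum is global. -/
theorem exists_min_sub_paraboloid {d : ℕ} {w : Rd d → ℝ} (hw : Continuous w)
    (hw0 : ∀ x, 0 ≤ w x) {r t : ℝ} (hr : 0 < r) (ht : 0 < t) {x₀ : Rd d} (hx₀ : ‖x₀‖ ≤ r / 4)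
    (hlt : w x₀ < 3 / 4 * t) :
    ∃ x, ‖x‖ ≤ r / 2 ∧ w x ≤ t ∧
      ∀ y, w x - t * max 0 (1 - 4 * (‖x‖ / r) ^ 2) ≤ w y - t * max 0 (1 - 4 * (‖y‖ / r) ^ 2) := by
  have hcont : Continuous fun y => w y - t * max 0 (1 - 4 * (‖y‖ / r) ^ 2) := by fun_prop
  have hmem : x₀ ∈ Metric.closedBall (0 : Rd d) (r / 2) := by
    rw [mem_closedBall_zero_iff]; linarith
  obtain ⟨x, hx, hmin⟩ := (isCompact_closedBall (0 : Rd d) (r / 2)).exists_isMinOn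
    ⟨x₀, hmem⟩ hcont.continuousOn
  have hneg : w x - t * max 0 (1 - 4 * (‖x‖ / r) ^ 2) < 0 := by
    refine (hmin hmem).trans_lt ?_
    have h1 : ‖x₀‖ / r ≤ 1 / 4 := by rw [div_le_iff₀ hr]; linarith
    have h2 : 3 / 4 ≤ 1 - 4 * (‖x₀‖ / r) ^ 2 := by
      have : 0 ≤ ‖x₀‖ / r := by positivity
      nlinarith
    have h3 := mul_le_mul_of_nonneg_left (h2.trans (le_max_right 0 _)) ht.le
    linarith
  refine ⟨x, by simpa using hx, ?_, fun y => ?_⟩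
  · have : max 0 (1 - 4 * (‖x‖ / r) ^ 2) ≤ 1 := max_le zero_le_one
      (by nlinarith [sq_nonneg (‖x‖ / r)])
    nlinarith
  · by_cases hy : y ∈ Metric.closedBall (0 : Rd d) (r / 2)
    · exact hmin hy
    · have hy' : 1 / 2 ≤ ‖y‖ / r := by
        rw [mem_closedBall_zero_iff, not_le] at hy
        rw [le_div_iff₀ hr]; linarith
      rw [max_eq_left (a := (0 : ℝ)) (b := 1 - 4 * (‖y‖ / r) ^ 2) (by nlinarith), mul_zero, sub_zero]
      exact hneg.le.trans (hw0 y)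

theorem secondDiff_ge_of_touching {d : ℕ} {w : Rd d → ℝ} {r t : ℝ}
    (hr : 0 < r) (ht : 0 < t) {x : Rd d} (hx : ‖x‖ ≤ r / 2) (hwx : w x ≤ t)
    (hmin : ∀ y, w x - t * max 0 (1 - 4 * (‖x‖ / r) ^ 2) ≤
      w y - t * max 0 (1 - 4 * (‖y‖ / r) ^ 2)) (h : Rd d) :
    {y : Rd d | r < ‖y‖}.indicator w (x + h) - 8 * t * min 1 ((‖h‖ / r) ^ 2) ≤
      secondDiff w x h := by
  have hxle : ‖x‖ / r ≤ 1 / 2 := by rw [div_le_iff₀ hr]; linarith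
  have hx0 : 0 ≤ ‖x‖ / r := by positivity
  have hφx : max 0 (1 - 4 * (‖x‖ / r) ^ 2) = 1 - 4 * (‖x‖ / r) ^ 2 :=
    max_eq_right (by nlinarith)
  have hcrude (y : Rd d) : -t ≤ w y - w x := by
    have h1 := hmin y
    have h2 : 0 ≤ t * max 0 (1 - 4 * (‖y‖ / r) ^ 2) := by positivity
    rw [hφx] at h1
    nlinarith [sq_nonneg (‖x‖ / r)]
  by_cases hy : r < ‖x + h‖
  · rw [indicator_of_mem (show x + h ∈ {y : Rd d | r < ‖y‖} from hy)]
    have hh : 1 / 2 ≤ ‖h‖ / r := by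
      rw [le_div_iff₀ hr]; linarith [norm_add_le x h]
    -- Jumps beyond radius `r` have length at least `r / 2`, so the penalty `8 * t * min` covers the
    -- loss `2 * t`.
    have hm : 1 / 4 ≤ min 1 ((‖h‖ / r) ^ 2) := le_min (by norm_num) (by nlinarith)
    have := hcrude (x - h)
    simp only [secondDiff]
    nlinarith
  · rw [indicator_of_notMem (show x + h ∉ {y : Rd d | r < ‖y‖} from hy)]
    rcases le_total 1 ((‖h‖ / r) ^ 2) with hm | hm
    · rw [min_eq_left hm]
      simp only [secondDiff]
      linarith [hcrude (x + h), hcrude (x - h)]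
    · rw [min_eq_right hm]
      have h1 := hmin (x + h)
      have h2 := hmin (x - h)
      have h3 := mul_le_mul_of_nonneg_left (le_max_right 0 (1 - 4 * (‖x + h‖ / r) ^ 2)) ht.le
      have h4 := mul_le_mul_of_nonneg_left (le_max_right 0 (1 - 4 * (‖x - h‖ / r) ^ 2)) ht.le
      -- By the parallelogram law the paraboloid has second difference exactly `-8 * t * (‖h‖ / r) ^
      -- 2`, whence the 8.
      have hpar : (‖x + h‖ / r) ^ 2 + (‖x - h‖ / r) ^ 2 =
          2 * ((‖x‖ / r) ^ 2 + (‖h‖ / r) ^ 2) := by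
        have := parallelogram_law_with_norm ℝ x h
        simp only [div_pow, ← add_div]
        rw [this]
        ring
      have hpar' := congrArg (t * ·) hpar
      rw [hφx] at h1 h2
      simp only [secondDiff]
      simp only [mul_add] at hpar'
      nlinarith

/-- If the bound failed at `x₀`, integrating the touching inequality against `K x` would make the
outer mass at most the cost of the bump, contrary to `hlt`. -/
theorem ge_of_outer_mass {d : ℕ} [NeZero d] {ℓ : ℝ → ℝ} {cL cU γ κ : ℝ}
    {K : Rd d → Rd d → ℝ} (hℓ : IsScaleFunction d ℓ cL cU γ) (hK : IsSymmetricKernel K)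
    (hκ : 1 ≤ κ) (hA1 : KernelComparable K ℓ κ) {w : Rd d → ℝ} (hw : Continuous w)
    (hw0 : ∀ x, 0 ≤ w x) (hint : ∀ x, Integrable fun h => secondDiff w x h * K x h)
    (hzero : ∀ x, ∫ h, secondDiff w x h * K x h = 0) {r t : ℝ} (hr : 0 < r) (ht : 0 < t)
    (hwk : Integrable fun y => w y * outerKernel d ℓ r y)
    (hlt : 8 * t * κ * ∫ h : Rd d, min 1 ((‖h‖ / r) ^ 2) * radialKernel d ℓ h <
      (κ * (cU + 2 ^ d * (cL⁻¹ * 2 ^ γ)))⁻¹ * ∫ y, w y * outerKernel d ℓ r y)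
    {x₀ : Rd d} (hx₀ : ‖x₀‖ ≤ r / 4) : 3 / 4 * t ≤ w x₀ := by
  by_contra! hcon
  obtain ⟨x, hx, hwx, hmin⟩ := exists_min_sub_paraboloid hw hw0 hr ht hx₀ hcon
  have hc := hℓ.cL_mem.1
  have hU := hℓ.one_le_cU
  have hp : (0 : ℝ) < 2 ^ γ := Real.rpow_pos_of_pos two_pos _
  set C := cU + 2 ^ d * (cL⁻¹ * 2 ^ γ) with hC
  have hC0 : 0 < C := by positivity
  have hae : ∀ᵐ h : Rd d, h ≠ 0 := by simp [ae_iff]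
  have hI1 := (hwk.comp_add_left x).const_mul (κ * C)⁻¹
  have hI2 := (hℓ.integrable_quadratic_radialKernel hr).const_mul (8 * t * κ)
  have hle : ∫ h, ((κ * C)⁻¹ * (w (x + h) * outerKernel d ℓ r (x + h)) -
      8 * t * κ * (min 1 ((‖h‖ / r) ^ 2) * radialKernel d ℓ h)) ≤
      ∫ h, secondDiff w x h * K x h := by
    refine integral_mono_ae (hI1.sub hI2) (hint x) ?_
    filter_upwards [hae] with h hh
    have hK0 := hK.nonneg x h hh
    have hJ := hℓ.radialKernel_pos hh
    have hKu : K x h ≤ κ * radialKernel d ℓ h := (hA1 x h hh).2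
    have hKl : κ⁻¹ * radialKernel d ℓ h ≤ K x h := (hA1 x h hh).1
    have h1 := mul_le_mul_of_nonneg_right
      (secondDiff_ge_of_touching hr ht hx hwx hmin h) hK0
    refine le_trans ?_ h1
    rw [sub_mul]
    have h2 : 8 * t * min 1 ((‖h‖ / r) ^ 2) * K x h ≤
        8 * t * κ * (min 1 ((‖h‖ / r) ^ 2) * radialKernel d ℓ h) := by
      calc _ ≤ 8 * t * min 1 ((‖h‖ / r) ^ 2) * (κ * radialKernel d ℓ h) := by gcongr
        _ = _ := by ring
    refine sub_le_sub ?_ h2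
    by_cases hy : r < ‖x + h‖
    · rw [indicator_of_mem (show x + h ∈ {y : Rd d | r < ‖y‖} from hy), outerKernel_of_lt ℓ hy,
        mul_left_comm]
      refine mul_le_mul_of_nonneg_left ?_ (hw0 _)
      calc (κ * C)⁻¹ * radialKernel d ℓ (x + h)
          ≤ (κ * C)⁻¹ * (C * radialKernel d ℓ h) := by
            gcongr
            exact hℓ.radialKernel_translate_le hr hx hy
        _ = κ⁻¹ * radialKernel d ℓ h := by field_simp
        _ ≤ K x h := hKl
    · rw [indicator_of_notMem (show x + h ∉ {y : Rd d | r < ‖y‖} from hy),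
        outerKernel_of_le ℓ (not_lt.1 hy)]
      simp
  -- Translation invariance removes the contact point `x` from the mass term.
  rw [hzero, integral_sub hI1 hI2, integral_const_mul, integral_const_mul,
    integral_add_left_eq_self (fun y => w y * outerKernel d ℓ r y)] at hle
  linarith

/-! ### Vanishing of the oscillation. -/

theorem not_lt_of_nonlocalOp_eq_zero {d : ℕ} [NeZero d] {ℓ : ℝ → ℝ}
    {cL cU γ κ : ℝ} {K : Rd d → Rd d → ℝ} (hℓ : IsScaleFunction d ℓ cL cU γ)
    (hK : IsSymmetricKernel K) (hκ : 1 ≤ κ) (hA1 : KernelComparable K ℓ κ) {u : Rd d → ℝ}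
    (hu : IsC2b u) (hAu : ∀ x, nonlocalOp K u x = 0) (a b : Rd d) : ¬ u a < u b := by
  intro hab
  have hc := hℓ.cL_mem.1
  have hU := hℓ.one_le_cU
  have hγ : 0 < 2 - γ := by linarith [hℓ.γ_mem.2]
  have hp : (0 : ℝ) < 2 ^ γ := Real.rpow_pos_of_pos two_pos _
  have hcont : Continuous u := hu.1.continuous
  obtain ⟨B, hB⟩ := hu.exists_bound
  have hbddA : BddAbove (range u) := ⟨B, by rintro _ ⟨x, rfl⟩; exact (abs_le.1 (hB x)).2⟩
  have hbddB : BddBelow (range u) := ⟨-B, by rintro _ ⟨x, rfl⟩; exact (abs_le.1 (hB x)).1⟩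
  set M := sSup (range u)
  set m := sInf (range u)
  have hM (x) : u x ≤ M := le_csSup hbddA (mem_range_self x)
  have hm (x) : m ≤ u x := csInf_le hbddB (mem_range_self x)
  have hS : 0 < M - m := by linarith [hM b, hm a]
  set C₀ := cU + 2 ^ d * (cL⁻¹ * 2 ^ γ) with hC₀
  set C₁ := (cL * (2 - γ))⁻¹ * (cL * ((2 : ℝ) ^ γ)⁻¹ / 2)⁻¹ + 1 with hC₁
  have hC₀0 : 0 < C₀ := by positivity
  have hC₁0 : 0 < C₁ := by positivity
  obtain ⟨t, ht, htC⟩ : ∃ t, 0 < t ∧ 8 * t * κ * C₁ < (κ * C₀)⁻¹ * ((M - m) / 2) := by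
    -- This `t` makes the left side half of the right; it is fixed before `r`.
    refine ⟨(κ * C₀)⁻¹ * ((M - m) / 2) / (16 * κ * C₁), by positivity, ?_⟩
    have : 0 < (κ * C₀)⁻¹ * ((M - m) / 2) := by positivity
    field_simp
    norm_num
  obtain ⟨_, ⟨xM, rfl⟩, hxM⟩ := exists_lt_of_lt_csSup (range_nonempty u)
    (show M - 3 / 4 * t < M by linarith)
  obtain ⟨_, ⟨xm, rfl⟩, hxm⟩ := exists_lt_of_csInf_lt (range_nonempty u)
    (show m < m + 3 / 4 * t by linarith)
  obtain ⟨r, hr, hrM, hrm⟩ : ∃ r : ℝ, 0 < r ∧ ‖xM‖ ≤ r / 4 ∧ ‖xm‖ ≤ r / 4 :=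
    ⟨4 * (‖xM‖ + ‖xm‖ + 1), by positivity, by linarith [norm_nonneg xm],
      by linarith [norm_nonneg xM]⟩
  have hk := hℓ.integrable_outerKernel hr
  have hΛ := hℓ.integral_outerKernel_pos hr
  have hQ := hℓ.integral_quadratic_radialKernel_le hr
  set Λ := ∫ h, outerKernel d ℓ r h
  have hlt {w : Rd d → ℝ} (hw : (M - m) / 2 * Λ ≤ ∫ y, w y * outerKernel d ℓ r y) :
      8 * t * κ * ∫ h : Rd d, min 1 ((‖h‖ / r) ^ 2) * radialKernel d ℓ h <
        (κ * C₀)⁻¹ * ∫ y, w y * outerKernel d ℓ r y := by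
    calc _ ≤ 8 * t * κ * (C₁ * Λ) := by gcongr
      _ = (8 * t * κ * C₁) * Λ := by ring
      _ < ((κ * C₀)⁻¹ * ((M - m) / 2)) * Λ := by gcongr
      _ = (κ * C₀)⁻¹ * ((M - m) / 2 * Λ) := by ring
      _ ≤ _ := by gcongr
  have hint := integrable_secondDiff hℓ hK hA1 hu
  have hzero (x) : ∫ h, secondDiff u x h * K x h = 0 := by
    rw [integral_secondDiff hℓ hK hA1 hu, hAu, mul_zero]
  have huk : Integrable fun y => u y * outerKernel d ℓ r y :=
    hk.bdd_mul hcont.aestronglyMeasurable (.of_forall hB)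
  have h1k : Integrable fun y => (M - u y) * outerKernel d ℓ r y := by
    simp only [sub_mul]
    exact (hk.const_mul M).sub huk
  have h2k : Integrable fun y => (u y - m) * outerKernel d ℓ r y := by
    simp only [sub_mul]
    exact huk.sub (hk.const_mul m)
  have hsum : (∫ y, (M - u y) * outerKernel d ℓ r y) + ∫ y, (u y - m) * outerKernel d ℓ r y =
      (M - m) * Λ := by
    rw [← integral_add h1k h2k, ← integral_const_mul]
    exact integral_congr_ae (.of_forall fun y => by ring)
  rcases le_total ((M - m) / 2 * Λ) (∫ y, (M - u y) * outerKernel d ℓ r y) with h | h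
  · have hsd (x h) : secondDiff (fun y => M - u y) x h * K x h =
        -(secondDiff u x h * K x h) := by simp only [secondDiff]; ring
    have := ge_of_outer_mass hℓ hK hκ hA1 (w := fun y => M - u y) (by fun_prop)
      (fun x => sub_nonneg.2 (hM x)) (fun x => by simp only [hsd]; exact (hint x).neg)
      (fun x => by simp only [hsd, integral_neg, hzero, neg_zero]) hr ht h1k (hlt h) hrM
    linarith
  · have hsd (x h) : secondDiff (fun y => u y - m) x h = secondDiff u x h := by
      simp only [secondDiff]; ring
    have := ge_of_outer_mass hℓ hK hκ hA1 (w := fun y => u y - m) (by fun_prop)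
      (fun x => sub_nonneg.2 (hm x)) (fun x => by simpa only [hsd] using hint x)
      (fun x => by simp only [hsd, hzero]) hr ht h2k (hlt (by linarith)) hrm
    linarith

end NonlocalLiouville

theorem mainTheorem5 (d : ℕ) (ℓ : ℝ → ℝ) (cL cU γ κ : ℝ)
    (K : NonlocalLiouville.Rd d → NonlocalLiouville.Rd d → ℝ)
    (hℓ : NonlocalLiouville.IsScaleFunction d ℓ cL cU γ)
    (hK : NonlocalLiouville.IsSymmetricKernel K)
    (hκ : 1 ≤ κ)
    (hA1 : NonlocalLiouville.KernelComparable K ℓ κ)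
    (u : NonlocalLiouville.Rd d → ℝ)
    (hu : NonlocalLiouville.IsC2b u)
    (hAu : ∀ x, NonlocalLiouville.nonlocalOp K u x = 0) :
    ∃ c : ℝ, ∀ x, u x = c := by
  refine ⟨u 0, fun x => ?_⟩
  rcases Nat.eq_zero_or_pos d with rfl | hd
  -- In dimension zero the space is a single point.
  · rw [Subsingleton.elim x 0]
  · have : NeZero d := ⟨hd.ne'⟩
    have h := NonlocalLiouville.not_lt_of_nonlocalOp_eq_zero hℓ hK hκ hA1 hu hAu
    exact le_antisymm (not_lt.1 (h 0 x)) (not_lt.1 (h x 0))
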